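/- Let $n\ge 1$ and $m\ge 2$ be integers. The Sierpinski graph $S(n,m)$ has vertex set $\{0,1,\dots,m-1\}^n$, and two distinct vertices $u,v$ are adjacent if and only if there is $h\in\{1,\dots,n\}$ such that $u_i=v_i$ for all $i<h$, $u_h\neq v_h$, and $u_j=v_h$, $v_j=u_h$ for all $j>h$. For a finite graph $G=(V,E)$ and $S\subseteq V$ let $\Theta(S)$ be the set of edges with one end in $S$ and the other end outside $S$; for $0\le \ell\le |V|$ let $|\Theta|(G;\ell)=\min\{|\Theta(S)| : S\subseteq V,\ |S|=\ell\}$, and, if $|V|\ge 2$, let $$h(G)=\min\left\{\frac{|\Theta|(G;\ell)}{\ell} : \ell\in\mathbb{Z},\ 1\le \ell\le \frac{|V|}{2}\right\}$$ be the Cheeger constant of $G$. Then $$h(S(n,m))=\begin{cases}\dfrac{1}{2m^{n-2}} & \text{if } m \text{ is even},\\[2ex] \dfrac{m+1}{2m^{n-1}} & \text{if } m \text{ is odd}.\end{cases}$$ -/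

import Mathlib

/-- The generalized Sierpinski graph `S(n,m)`: the vertices are the `n`-tuples over
`{0, …, m-1}`, and `u`, `v` are adjacent iff there is a position `h` before which they agree,
at which they differ, and after which `u` is constantly `v h` and `v` is constantly `u h`. -/
def sierpinskiGraph (n m : ℕ) : SimpleGraph (Fin n → Fin m) where
  Adj u v := ∃ h : Fin n,
    (∀ i, i < h → u i = v i) ∧ u h ≠ v h ∧ ∀ j, h < j → u j = v h ∧ v j = u h
  symm := ⟨by
    rintro u v ⟨h, h₁, h₂, h₃⟩
    exact ⟨h, fun i hi => (h₁ i hi).symm, h₂.symm, fun j hj => (h₃ j hj).symm⟩⟩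
  loopless := ⟨by
    rintro u ⟨h, _, h₂, _⟩
    exact h₂ rfl⟩

/-- The edge boundary `Θ(S)`: the edges with one end in `S` and the other end outside `S`. -/
def edgeBoundary {V : Type*} (G : SimpleGraph V) (S : Finset V) : Set (Sym2 V) :=
  {e | e ∈ G.edgeSet ∧ ∃ v w, e = s(v, w) ∧ v ∈ S ∧ w ∉ S}

/-- The edge-isoperimetric profile `|Θ|(G; ℓ) = min {|Θ(S)| : S ⊆ V, |S| = ℓ}`. It is meant for
`ℓ ≤ |V|`, where the minimum is over a nonempty set. -/
noncomputable def isoperimetricProfile {V : Type*} (G : SimpleGraph V) (l : ℕ) : ℕ :=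
  sInf {b | ∃ S : Finset V, S.card = l ∧ (edgeBoundary G S).ncard = b}

/-- The quotients `|Θ|(G; ℓ) / ℓ` for `1 ≤ ℓ ≤ |V| / 2`. -/
def cheegerQuotients {V : Type*} [Fintype V] (G : SimpleGraph V) : Set ℝ :=
  {r | ∃ l : ℕ, 1 ≤ l ∧ (l : ℝ) ≤ (Fintype.card V : ℝ) / 2 ∧
    r = (isoperimetricProfile G l : ℝ) / (l : ℝ)}

/-- The Cheeger constant `h(G) = min {|Θ|(G; ℓ) / ℓ : 1 ≤ ℓ ≤ |V| / 2}`. It is meant for graphs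
with at least two vertices, where the infimum is a minimum: see `cheegerConstant_isLeast`. -/
noncomputable def cheegerConstant {V : Type*} [Fintype V] (G : SimpleGraph V) : ℝ :=
  sInf (cheegerQuotients G)

/-- The profile is a minimum, attained by some set of `ℓ` vertices, whenever `ℓ ≤ |V|`. -/
theorem isoperimetricProfile_isLeast {V : Type*} [Fintype V] (G : SimpleGraph V) (l : ℕ)
    (hl : l ≤ Fintype.card V) :
    IsLeast {b | ∃ S : Finset V, S.card = l ∧ (edgeBoundary G S).ncard = b}
      (isoperimetricProfile G l) := by
  have hne : {b | ∃ S : Finset V, S.card = l ∧ (edgeBoundary G S).ncard = b}.Nonempty := by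
    obtain ⟨S, _, hS⟩ := Finset.exists_subset_card_eq
      (s := (Finset.univ : Finset V)) (n := l) (by simpa using hl)
    exact ⟨_, S, hS, rfl⟩
  exact ⟨Nat.sInf_mem hne, fun b hb => Nat.sInf_le hb⟩

/-- The Cheeger constant is a minimum for every graph with at least two vertices. -/
theorem cheegerConstant_isLeast {V : Type*} [Fintype V] (G : SimpleGraph V)
    (hV : 2 ≤ Fintype.card V) : IsLeast (cheegerQuotients G) (cheegerConstant G) := by
  have hne : (cheegerQuotients G).Nonempty := by
    refine ⟨_, 1, le_rfl, ?_, rfl⟩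
    have : (2 : ℝ) ≤ (Fintype.card V : ℝ) := by exact_mod_cast hV
    push_cast
    linarith
  have hfin : (cheegerQuotients G).Finite := by
    refine ((Set.finite_Iic (Fintype.card V)).image
      (fun l : ℕ => (isoperimetricProfile G l : ℝ) / (l : ℝ))).subset ?_
    rintro r ⟨l, _, hl, rfl⟩
    refine ⟨l, ?_, rfl⟩
    have h0 : (0 : ℝ) ≤ (Fintype.card V : ℝ) := Nat.cast_nonneg _
    have : (l : ℝ) ≤ (Fintype.card V : ℝ) := by linarith
    exact_mod_cast this
  exact ⟨hne.csInf_mem hfin, fun r hr => csInf_le hfin.bddBelow hr⟩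

/-! A vertex set is a 0/1 function, and its variation is twice the edge boundary, so the lower bound
is an inequality between variation and density d. S(n+1,m) is m copies of S(n,m), any two joined by
one edge between corners. Induction on this structure gives `sum_corner_sub_mean_le_variation` for
real functions. A 0/1 function differs from d by at least min(d, 1-d) at each of the m corners,
which settles even m.

For odd m this yields m/2 where (m+1)/2 is needed. A second induction,
`min_mean_le_variation_of_odd`, mixes the corner bound with its own hypothesis inside each copy and
leaves `odd_block_inequality`, about the m block densities. The union of ⌊m/2⌋ whole copies attains
both bounds. -/

/-! ### Variation, mean and their recursions -/

/-- The total variation of `x` along the edges of the Sierpinski graph, each edge being counted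
in both directions. -/
noncomputable def sierpinskiVariation (n m : ℕ) (x : (Fin n → Fin m) → ℝ) : ℝ := by
  classical
  exact ∑ u, ∑ v, if (sierpinskiGraph n m).Adj u v then |x u - x v| else 0

theorem sierpinskiGraph_adj_cons {n m : ℕ} (i j : Fin m) (u v : Fin n → Fin m) :
    (sierpinskiGraph (n + 1) m).Adj (Fin.cons i u) (Fin.cons j v) ↔
      (i = j ∧ (sierpinskiGraph n m).Adj u v) ∨
        (i ≠ j ∧ u = (fun _ => j) ∧ v = (fun _ => i)) := by
  constructor
  · rintro ⟨h, h₁, h₂, h₃⟩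
    induction h using Fin.cases with
    | zero =>
      refine Or.inr ⟨by simpa using h₂, ?_, ?_⟩
      · funext l
        simpa using (h₃ l.succ (Fin.succ_pos l)).1
      · funext l
        simpa using (h₃ l.succ (Fin.succ_pos l)).2
    | succ h =>
      refine Or.inl ⟨by simpa using h₁ 0 (Fin.succ_pos h), h, fun l hl => ?_, by simpa using h₂,
        fun l hl => ?_⟩
      · simpa using h₁ l.succ (Fin.succ_lt_succ_iff.mpr hl)
      · simpa using h₃ l.succ (Fin.succ_lt_succ_iff.mpr hl)
  · rintro (⟨rfl, h, h₁, h₂, h₃⟩ | ⟨hij, rfl, rfl⟩)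
    · refine ⟨h.succ, fun l hl => ?_, by simpa using h₂, fun l hl => ?_⟩
      · induction l using Fin.cases with
        | zero => simp
        | succ l => simpa using h₁ l (Fin.succ_lt_succ_iff.mp hl)
      · induction l using Fin.cases with
        | zero => simp at hl
        | succ l => simpa using h₃ l (Fin.succ_lt_succ_iff.mp hl)
    · refine ⟨0, fun l hl => absurd hl (Fin.not_lt_zero l), by simpa using hij, fun l hl => ?_⟩
      induction l using Fin.cases with
      | zero => simp at hl
      | succ l => simp

theorem sum_fin_cons {n m : ℕ} {M : Type*} [AddCommMonoid M] (f : (Fin (n + 1) → Fin m) → M) :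
    ∑ u, f u = ∑ i : Fin m, ∑ u : Fin n → Fin m, f (Fin.cons i u) := by
  rw [← (Fin.consEquiv (fun _ : Fin (n + 1) => Fin m)).sum_comp, Fintype.sum_prod_type]
  rfl

theorem sierpinskiVariation_nonneg (n m : ℕ) (x : (Fin n → Fin m) → ℝ) :
    0 ≤ sierpinskiVariation n m x := by
  unfold sierpinskiVariation
  refine Finset.sum_nonneg fun u _ => Finset.sum_nonneg fun v _ => ?_
  split_ifs <;> positivity

theorem sierpinskiVariation_succ (n m : ℕ) (x : (Fin (n + 1) → Fin m) → ℝ) :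
    sierpinskiVariation (n + 1) m x =
      ∑ i, sierpinskiVariation n m (fun u => x (Fin.cons i u)) +
        ∑ i : Fin m, ∑ j : Fin m,
          |x (Fin.cons i fun _ => j) - x (Fin.cons j fun _ => i)| := by
  classical
  -- The last term needs no condition `i ≠ j`: it vanishes when `i = j`.
  have key : ∀ (i j : Fin m) (u v : Fin n → Fin m),
      (if (sierpinskiGraph (n + 1) m).Adj (Fin.cons i u) (Fin.cons j v) then
        |x (Fin.cons i u) - x (Fin.cons j v)| else 0) =
      (if i = j then (if (sierpinskiGraph n m).Adj u v then
        |x (Fin.cons i u) - x (Fin.cons i v)| else 0) else 0) +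
      (if u = (fun _ => j) then (if v = (fun _ => i) then
        |x (Fin.cons i fun _ => j) - x (Fin.cons j fun _ => i)| else 0) else 0) := by
    intro i j u v
    simp only [sierpinskiGraph_adj_cons]
    by_cases hij : i = j
    · subst hij
      simp
    · by_cases hu : u = fun _ => j
      · by_cases hv : v = fun _ => i
        · simp [hij, hu, hv]
        · simp [hij, hv]
      · simp [hij, hu]
  unfold sierpinskiVariation
  simp_rw [sum_fin_cons, key]
  rw [← Finset.sum_add_distrib]
  refine Finset.sum_congr rfl fun i _ => ?_
  rw [Finset.sum_comm' (t' := Finset.univ) (s' := fun _ => Finset.univ) (by simp)]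
  simp_rw [Finset.sum_add_distrib]
  congr 1
  · rw [Finset.sum_comm]
    refine Finset.sum_congr rfl fun u _ => ?_
    rw [Finset.sum_comm]
    refine Finset.sum_congr rfl fun v _ => ?_
    simp
  · refine Finset.sum_congr rfl fun j _ => ?_
    simp

/-- The average of `x` over all vertices. -/
noncomputable def sierpinskiMean (n m : ℕ) (x : (Fin n → Fin m) → ℝ) : ℝ :=
  (∑ u, x u) / (m : ℝ) ^ n

theorem sierpinskiMean_succ (n m : ℕ) (x : (Fin (n + 1) → Fin m) → ℝ) :
    sierpinskiMean (n + 1) m x =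
      (∑ i, sierpinskiMean n m (fun u => x (Fin.cons i u))) / m := by
  unfold sierpinskiMean
  rw [sum_fin_cons, ← Finset.sum_div, div_div, pow_succ]

theorem sierpinskiMean_zero (m : ℕ) (x : (Fin 0 → Fin m) → ℝ) (u : Fin 0 → Fin m) :
    sierpinskiMean 0 m x = x u := by
  unfold sierpinskiMean
  rw [Fintype.sum_unique, pow_zero, div_one, Subsingleton.elim u default]

/-! ### The corner inequality -/

theorem sum_abs_sub_mean_le {m : ℕ} (hm : 0 < m) (t : Fin m → ℝ) :
    m * ∑ i, |t i - (∑ j, t j) / m| ≤ ∑ i, ∑ j, |t i - t j| := by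
  have hm' : (0 : ℝ) < m := by exact_mod_cast hm
  rw [Finset.mul_sum]
  refine Finset.sum_le_sum fun i _ => ?_
  have h : (m : ℝ) * |t i - (∑ j, t j) / m| = |∑ j, (t i - t j)| := by
    rw [Finset.sum_sub_distrib, ← abs_of_pos hm', ← abs_mul, abs_of_pos hm']
    congr 1
    simp
    field_simp
  rw [h]
  exact Finset.abs_sum_le_sum_abs _ _

/-- Triangle inequality along `t i`, `y i j`, `y j i`, `t j`. Each deviation serves two ordered
pairs, so it has weight `a / 2 ≥ 1` in each; diagonal deviations are not needed and survive on the
left. -/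
theorem abs_sub_transport_le {m : ℕ} {a : ℝ} (ha : 2 ≤ a) (t : Fin m → ℝ)
    (y : Fin m → Fin m → ℝ) :
    ∑ i, ∑ j, |t i - t j| + a * ∑ i, |y i i - t i| ≤
      a * ∑ i, ∑ j, |y i j - t i| + ∑ i, ∑ j, |y i j - y j i| := by
  have hswap : a * ∑ i, ∑ j, |y i j - t i| =
      ∑ i, ∑ j, a / 2 * (|y i j - t i| + |y j i - t j|) := by
    simp_rw [← Finset.mul_sum, Finset.sum_add_distrib]
    rw [Finset.sum_comm (f := fun i j => |y j i - t j|)]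
    ring
  have hdiag : a * ∑ i, |y i i - t i| =
      ∑ i, ∑ j, if i = j then a * |y i i - t i| else 0 := by
    simp [Finset.mul_sum]
  rw [hswap, hdiag]
  simp_rw [← Finset.sum_add_distrib]
  refine Finset.sum_le_sum fun i _ => Finset.sum_le_sum fun j _ => ?_
  split_ifs with hij
  · subst hij
    simp only [sub_self, abs_zero]
    linarith
  · have h : |t i - t j| ≤ |y i j - t i| + |y j i - t j| + |y i j - y j i| := by
      rw [abs_le]
      constructor <;>
        linarith [neg_abs_le (y i j - t i), le_abs_self (y i j - t i),
          neg_abs_le (y j i - t j), le_abs_self (y j i - t j),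
          neg_abs_le (y i j - y j i), le_abs_self (y i j - y j i)]
    nlinarith [abs_nonneg (y i j - t i), abs_nonneg (y j i - t j)]

theorem cons_self_const {n : ℕ} {α : Type*} (j : α) :
    (Fin.cons j (fun _ => j) : Fin (n + 1) → α) = fun _ => j := by
  funext l
  induction l using Fin.cases <;> simp

/-- The corners of a Sierpinski graph cannot deviate much from the mean without causing
variation along the edges. -/
theorem sum_corner_sub_mean_le_variation {m : ℕ} (hm : 2 ≤ m) (n : ℕ)
    (x : (Fin n → Fin m) → ℝ) :
    m * ∑ j : Fin m, |x (fun _ => j) - sierpinskiMean n m x| ≤ sierpinskiVariation n m x := by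
  have hm' : (2 : ℝ) ≤ m := by exact_mod_cast hm
  induction n with
  | zero =>
    rw [Finset.sum_eq_zero fun j _ => by rw [sierpinskiMean_zero m x fun _ => j, sub_self, abs_zero]]
    simpa using sierpinskiVariation_nonneg 0 m x
  | succ n ih =>
    rw [sierpinskiVariation_succ, sierpinskiMean_succ]
    have h1 := Finset.sum_le_sum fun i (_ : i ∈ Finset.univ) => ih fun u => x (Fin.cons i u)
    rw [← Finset.mul_sum] at h1
    set t : Fin m → ℝ := fun i => sierpinskiMean n m (fun u => x (Fin.cons i u))
    -- The surviving diagonal terms are the corners of the whole graph.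
    have h2 := abs_sub_transport_le hm' t fun i j => x (Fin.cons i fun _ => j)
    have h3 := sum_abs_sub_mean_le (by omega : 0 < m) t
    have h4 : m * ∑ j, |x (fun _ => j) - (∑ i, t i) / m| ≤
        m * ∑ i, |x (fun _ => i) - t i| + m * ∑ i, |t i - (∑ i, t i) / m| := by
      rw [← mul_add, ← Finset.sum_add_distrib]
      gcongr with i
      exact abs_sub_le _ _ _
    simp_rw [cons_self_const] at h2
    linarith

/-! ### The inequality for odd m -/

theorem two_mul_sum_sub_le_sum_abs {m : ℕ} (t : Fin m → ℝ) (A : Finset (Fin m)) :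
    2 * (((m : ℝ) - A.card) * ∑ i ∈ A, t i - A.card * ∑ j ∈ Aᶜ, t j) ≤
      ∑ i, ∑ j, |t i - t j| := by
  have h1 : ∑ i ∈ A, ∑ j ∈ Aᶜ, |t i - t j| + ∑ i ∈ Aᶜ, ∑ j ∈ A, |t i - t j| ≤
      ∑ i, ∑ j, |t i - t j| := by
    rw [← Finset.sum_add_sum_compl A fun i => ∑ j, |t i - t j|]
    refine add_le_add (Finset.sum_le_sum fun i _ => ?_) (Finset.sum_le_sum fun i _ => ?_) <;>
      exact Finset.sum_le_sum_of_subset_of_nonneg (Finset.subset_univ _)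
        fun _ _ _ => abs_nonneg _
  have h2 : ∑ i ∈ Aᶜ, ∑ j ∈ A, |t i - t j| = ∑ i ∈ A, ∑ j ∈ Aᶜ, |t i - t j| := by
    rw [Finset.sum_comm]
    simp_rw [abs_sub_comm]
  have h3 : ∑ i ∈ A, ∑ j ∈ Aᶜ, (t i - t j) ≤ ∑ i ∈ A, ∑ j ∈ Aᶜ, |t i - t j| :=
    Finset.sum_le_sum fun i _ => Finset.sum_le_sum fun j _ => le_abs_self _
  have h4 : ∑ i ∈ A, ∑ j ∈ Aᶜ, (t i - t j) =
      ((m : ℝ) - A.card) * ∑ i ∈ A, t i - A.card * ∑ j ∈ Aᶜ, t j := by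
    have hc : ((Aᶜ.card : ℕ) : ℝ) = (m : ℝ) - A.card := by
      rw [Finset.card_compl, Fintype.card_fin, Nat.cast_sub]
      simpa using A.card_le_univ
    simp_rw [Finset.sum_sub_distrib, Finset.sum_const, nsmul_eq_mul, hc, ← Finset.mul_sum]
  linarith

/-- The block inequality for densities of total weight at most half of the number of blocks. -/
theorem odd_block_inequality_of_le {k m : ℕ} (hk : 1 ≤ k) (hmk : m = 2 * k + 1)
    (t : Fin m → ℝ) (h0 : ∀ i, 0 ≤ t i) (h1 : ∀ i, t i ≤ 1)
    (hsum : ∑ i, t i ≤ (m : ℝ) / 2) :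
    2 * ((k : ℝ) + 1) * ∑ i, t i ≤
      ∑ i, ∑ j, |t i - t j| + 2 * ((k : ℝ) * m) * ∑ i, min (t i) (1 - t i) := by
  classical
  set A : Finset (Fin m) := Finset.univ.filter fun i => 1 / 2 < t i
  have hA := two_mul_sum_sub_le_sum_abs t A
  have hmin : ∑ i, min (t i) (1 - t i) = (A.card - ∑ i ∈ A, t i) + ∑ i ∈ Aᶜ, t i := by
    rw [← Finset.sum_add_sum_compl A]
    congr 1
    · rw [Finset.card_eq_sum_ones, Nat.cast_sum, ← Finset.sum_sub_distrib]
      refine Finset.sum_congr rfl fun i hi => ?_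
      have : 1 / 2 < t i := by simpa [A] using hi
      rw [min_eq_right (by linarith)]
      simp
    · refine Finset.sum_congr rfl fun i hi => ?_
      have : t i ≤ 1 / 2 := by simpa [A] using hi
      rw [min_eq_left (by linarith)]
  have hB0 : 0 ≤ ∑ i ∈ Aᶜ, t i := Finset.sum_nonneg fun i _ => h0 i
  have hA0 : 0 ≤ ∑ i ∈ A, t i := Finset.sum_nonneg fun i _ => h0 i
  have hA1 : ∑ i ∈ A, t i ≤ A.card := by
    simpa using Finset.sum_le_card_nsmul A t 1 fun i _ => h1 i
  rw [← Finset.sum_add_sum_compl A] at hsum ⊢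
  rw [hmin]
  set a := A.card
  have ham : a ≤ 2 * k := by
    by_contra hlt
    have hau : A = Finset.univ := by
      rw [← Finset.card_eq_iff_eq_univ, Fintype.card_fin]
      have : a ≤ m := by simpa using A.card_le_univ
      change a = m
      omega
    have hne : (Finset.univ : Finset (Fin m)).Nonempty := ⟨⟨0, by omega⟩, Finset.mem_univ _⟩
    have hlt2 : ∑ _i : Fin m, (1 / 2 : ℝ) < ∑ i, t i := by
      refine Finset.sum_lt_sum_of_nonempty hne fun i _ => ?_
      have : i ∈ A := hau ▸ Finset.mem_univ i
      simpa [A] using this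
    rw [Finset.sum_add_sum_compl] at hsum
    simp at hlt2
    linarith
  have hkR : (1 : ℝ) ≤ k := by exact_mod_cast hk
  have hmR : (m : ℝ) = 2 * k + 1 := by rw [hmk]; push_cast; ring
  have haR : (a : ℝ) ≤ 2 * k := by exact_mod_cast ham
  set TA := ∑ i ∈ A, t i
  set TB := ∑ i ∈ Aᶜ, t i
  rw [hmR] at *
  -- Half the difference of the two sides, once only pairs crossing `A` are kept.
  suffices h : 0 ≤ ((k : ℝ) - a) * TA + k * (2 * k + 1) * (a - TA) + (2 * k ^ 2 - 1 - a) * TB by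
    linarith
  rcases le_or_gt a k with hak | hak
  · have hakR : (a : ℝ) ≤ k := by exact_mod_cast hak
    have e1 : 0 ≤ ((k : ℝ) - a) * TA := mul_nonneg (by linarith) hA0
    have e2 : 0 ≤ (k : ℝ) * (2 * k + 1) * (a - TA) := mul_nonneg (by positivity) (by linarith)
    have e3 : 0 ≤ (2 * (k : ℝ) ^ 2 - 1 - a) * TB := mul_nonneg (by nlinarith) hB0
    linarith
  · have hakR : (k : ℝ) + 1 ≤ a := by exact_mod_cast hak
    -- From `TA + TB ≤ k + 1/2` and `a - k ≥ 1`.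
    have e1 : (k : ℝ) * (2 * k + 1) * ((a - k) / 2 + TB) ≤ k * (2 * k + 1) * (a - TA) := by
      gcongr
      linarith
    have e2 : ((a : ℝ) - k) * TA ≤ (a - k) * (k + 1 / 2) := by
      gcongr
      · linarith
      · linarith
    have e3 : 0 ≤ (k * (2 * k + 1) + (2 * (k : ℝ) ^ 2 - 1 - a)) * TB :=
      mul_nonneg (by nlinarith) hB0
    have e4 : 0 ≤ ((a : ℝ) - k) * ((2 * k + 1) * (k - 1)) :=
      mul_nonneg (by linarith) (mul_nonneg (by linarith) (by linarith))
    linarith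

/-- Replacing `t` by `1 - t` reduces to total weight at most `m / 2`. -/
theorem odd_block_inequality {k m : ℕ} (hk : 1 ≤ k) (hmk : m = 2 * k + 1)
    (t : Fin m → ℝ) (h0 : ∀ i, 0 ≤ t i) (h1 : ∀ i, t i ≤ 1) :
    2 * ((k : ℝ) + 1) * min (∑ i, t i) (m - ∑ i, t i) ≤
      ∑ i, ∑ j, |t i - t j| + 2 * ((k : ℝ) * m) * ∑ i, min (t i) (1 - t i) := by
  rcases le_total (∑ i, t i) ((m : ℝ) / 2) with h | h
  · refine le_trans ?_ (odd_block_inequality_of_le hk hmk t h0 h1 h)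
    gcongr
    exact min_le_left _ _
  · have hs : ∑ i, (1 - t i) = m - ∑ i, t i := by simp
    have := odd_block_inequality_of_le hk hmk (fun i => 1 - t i) (fun i => by linarith [h1 i])
      (fun i => by linarith [h0 i]) (by rw [hs]; linarith)
    simp only [sub_sub_sub_cancel_left, sub_sub_cancel, hs] at this
    simp_rw [fun i j => abs_sub_comm (t j) (t i), min_comm (1 - t _)] at this
    refine le_trans ?_ this
    gcongr
    exact min_le_right _ _

theorem sierpinskiMean_mem {n m : ℕ} (hm : 0 < m) {x : (Fin n → Fin m) → ℝ}
    (hx : ∀ u, x u = 0 ∨ x u = 1) :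
    0 ≤ sierpinskiMean n m x ∧ sierpinskiMean n m x ≤ 1 := by
  have hm' : (0 : ℝ) < (m : ℝ) ^ n := by positivity
  have h0 : ∀ u, 0 ≤ x u := fun u => by rcases hx u with h | h <;> simp [h]
  have h1 : ∀ u, x u ≤ 1 := fun u => by rcases hx u with h | h <;> simp [h]
  unfold sierpinskiMean
  refine ⟨div_nonneg (Finset.sum_nonneg fun u _ => h0 u) hm'.le, (div_le_one hm').2 ?_⟩
  simpa using Finset.sum_le_card_nsmul Finset.univ x 1 fun u _ => h1 u

/-- The isoperimetric inequality for an odd number of symbols. -/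
theorem min_mean_le_variation_of_odd {k m : ℕ} (hk : 1 ≤ k) (hmk : m = 2 * k + 1) (n : ℕ)
    (x : (Fin n → Fin m) → ℝ) (hx : ∀ u, x u = 0 ∨ x u = 1) :
    2 * ((k : ℝ) + 1) * m * min (sierpinskiMean n m x) (1 - sierpinskiMean n m x) ≤
      sierpinskiVariation n m x := by
  have hm : 0 < m := by omega
  have hmR : (m : ℝ) = 2 * k + 1 := by rw [hmk]; push_cast; ring
  have hkR : (1 : ℝ) ≤ k := by exact_mod_cast hk
  have hm0 : (0 : ℝ) < m := by exact_mod_cast hm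
  induction n with
  | zero =>
    refine le_trans (le_of_eq ?_) (sierpinskiVariation_nonneg 0 m x)
    rw [sierpinskiMean_zero m x fun _ => ⟨0, hm⟩]
    rcases hx fun _ => ⟨0, hm⟩ with h | h <;> simp [h]
  | succ n ih =>
    rw [sierpinskiVariation_succ, sierpinskiMean_succ]
    set t : Fin m → ℝ := fun i => sierpinskiMean n m (fun u => x (Fin.cons i u))
    have htm : ∀ i, 0 ≤ t i ∧ t i ≤ 1 := fun i => sierpinskiMean_mem hm fun u => hx _
    -- Weights 2/m on the corner bound and (m-2)/m on the induction hypothesis: 2 is the least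
    -- weight the transport step allows.
    have hblock : ∀ i, 2 * ∑ j : Fin m, |x (Fin.cons i fun _ => j) - t i| +
        2 * ((m : ℝ) - 2) * (k + 1) * min (t i) (1 - t i) ≤
        sierpinskiVariation n m (fun u => x (Fin.cons i u)) := fun i => by
      have hP := sum_corner_sub_mean_le_variation (by omega : 2 ≤ m) n
        fun u => x (Fin.cons i u)
      have hQ := ih (fun u => x (Fin.cons i u)) fun u => hx _
      refine le_of_mul_le_mul_left ?_ hm0
      have hQ' := mul_le_mul_of_nonneg_left hQ (by linarith : (0 : ℝ) ≤ m - 2)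
      linarith
    have hblocks := Finset.sum_le_sum fun i (_ : i ∈ Finset.univ) => hblock i
    rw [Finset.sum_add_distrib, ← Finset.mul_sum, ← Finset.mul_sum] at hblocks
    have htr := abs_sub_transport_le le_rfl t fun i j => x (Fin.cons i fun _ => j)
    -- Adds 2 to the coefficient of the minima: 2(m-2)(k+1) + 2 = 2km.
    have hdiag : ∑ i, min (t i) (1 - t i) ≤ ∑ i, |x (Fin.cons i fun _ => i) - t i| := by
      refine Finset.sum_le_sum fun i _ => ?_
      rcases hx (Fin.cons i fun _ => i) with h | h
      · rw [h, zero_sub, abs_neg, abs_of_nonneg (htm i).1]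
        exact min_le_left _ _
      · rw [h, abs_of_nonneg (by linarith [(htm i).2])]
        exact min_le_right _ _
    have hmain := odd_block_inequality hk hmk t (fun i => (htm i).1) fun i => (htm i).2
    have hscale : 2 * ((k : ℝ) + 1) * m * min ((∑ i, t i) / m) (1 - (∑ i, t i) / m) =
        2 * ((k : ℝ) + 1) * min (∑ i, t i) (m - ∑ i, t i) := by
      rw [mul_assoc, mul_min_of_nonneg _ _ hm0.le, mul_sub, mul_div_cancel₀ _ hm0.ne', mul_one]
    rw [hscale]
    refine hmain.trans ?_
    rw [hmR] at hblocks ⊢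
    linarith

/-- The isoperimetric inequality in the form that holds for every number of symbols. -/
theorem min_mean_le_variation {m : ℕ} (hm : 2 ≤ m) (n : ℕ)
    (x : (Fin n → Fin m) → ℝ) (hx : ∀ u, x u = 0 ∨ x u = 1) :
    (m : ℝ) * m * min (sierpinskiMean n m x) (1 - sierpinskiMean n m x) ≤
      sierpinskiVariation n m x := by
  refine le_trans ?_ (sum_corner_sub_mean_le_variation hm n x)
  have ht := sierpinskiMean_mem (by omega : 0 < m) hx
  rw [mul_assoc]
  gcongr
  have h := Finset.card_nsmul_le_sum Finset.univ
    (fun j : Fin m => |x (fun _ => j) - sierpinskiMean n m x|)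
    (min (sierpinskiMean n m x) (1 - sierpinskiMean n m x)) fun j _ => by
      rcases hx fun _ => j with h | h
      · rw [h, zero_sub, abs_neg, abs_of_nonneg ht.1]
        exact min_le_left _ _
      · rw [h, abs_of_nonneg (by linarith [ht.2])]
        exact min_le_right _ _
  simpa using h

/-! ### From functions to edge boundaries -/

theorem ncard_edgeBoundary {V : Type*} [Fintype V] [DecidableEq V] (G : SimpleGraph V)
    [DecidableRel G.Adj] (S : Finset V) :
    (edgeBoundary G S).ncard =
      ((S ×ˢ Sᶜ).filter fun p : V × V => G.Adj p.1 p.2).card := by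
  have himg : edgeBoundary G S = (fun p : V × V => s(p.1, p.2)) ''
      ((S ×ˢ Sᶜ).filter fun p : V × V => G.Adj p.1 p.2 : Finset (V × V)) := by
    ext e
    constructor
    · rintro ⟨he, v, w, rfl, hv, hw⟩
      exact ⟨(v, w), by simpa [hv, hw] using he, rfl⟩
    · rintro ⟨⟨v, w⟩, hp, rfl⟩
      simp only [Finset.coe_filter, Finset.mem_product, Finset.mem_compl,
        Set.mem_ofPred_eq] at hp
      exact ⟨hp.2, v, w, rfl, hp.1.1, hp.1.2⟩
  rw [himg, Set.InjOn.ncard_image, Set.ncard_coe_finset]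
  rintro ⟨v, w⟩ hp ⟨v', w'⟩ hp' h
  simp only [Finset.coe_filter, Finset.mem_product, Finset.mem_compl,
    Set.mem_ofPred_eq] at hp hp'
  rcases Sym2.eq_iff.mp h with ⟨rfl, rfl⟩ | ⟨rfl, rfl⟩
  · rfl
  · exact absurd hp.1.1 hp'.1.2

theorem sierpinskiVariation_indicator {n m : ℕ} (S : Finset (Fin n → Fin m)) :
    sierpinskiVariation n m (fun u => if u ∈ S then 1 else 0) =
      2 * (edgeBoundary (sierpinskiGraph n m) S).ncard := by
  classical
  have hE : ((edgeBoundary (sierpinskiGraph n m) S).ncard : ℝ) =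
      ∑ u, ∑ v, if u ∈ S ∧ v ∉ S ∧ (sierpinskiGraph n m).Adj u v then 1 else 0 := by
    have hf : (S ×ˢ Sᶜ).filter (fun p => (sierpinskiGraph n m).Adj p.1 p.2) =
        Finset.univ.filter fun p => p.1 ∈ S ∧ p.2 ∉ S ∧ (sierpinskiGraph n m).Adj p.1 p.2 := by
      ext p
      simp [and_assoc]
    rw [ncard_edgeBoundary, hf, Finset.card_filter, Nat.cast_sum, Fintype.sum_prod_type]
    simp only [Nat.cast_ite, Nat.cast_one, Nat.cast_zero]
  have hE' : ((edgeBoundary (sierpinskiGraph n m) S).ncard : ℝ) =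
      ∑ u, ∑ v, if v ∈ S ∧ u ∉ S ∧ (sierpinskiGraph n m).Adj u v then 1 else 0 := by
    rw [hE, Finset.sum_comm]
    simp_rw [(sierpinskiGraph n m).adj_comm]
  rw [two_mul]
  nth_rewrite 1 [hE]
  rw [hE']
  unfold sierpinskiVariation
  simp_rw [← Finset.sum_add_distrib]
  refine Finset.sum_congr rfl fun u _ => Finset.sum_congr rfl fun v _ => ?_
  by_cases hu : u ∈ S <;> by_cases hv : v ∈ S <;> simp [hu, hv]

theorem sierpinskiMean_indicator {n m : ℕ} (S : Finset (Fin n → Fin m)) :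
    sierpinskiMean n m (fun u => if u ∈ S then 1 else 0) = S.card / (m : ℝ) ^ n := by
  classical
  simp [sierpinskiMean]

/-- The Cheeger constant is determined by a lower bound for all sets and one extremal set. -/
theorem cheegerConstant_eq {V : Type*} [Fintype V] (G : SimpleGraph V) {c : ℝ}
    (hlow : ∀ S : Finset V, (S.card : ℝ) ≤ (Fintype.card V : ℝ) / 2 →
      c * S.card ≤ (edgeBoundary G S).ncard)
    {S : Finset V} (hS1 : 1 ≤ S.card) (hS2 : (S.card : ℝ) ≤ (Fintype.card V : ℝ) / 2)
    (hS : ((edgeBoundary G S).ncard : ℝ) ≤ c * S.card) :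
    cheegerConstant G = c := by
  have hle : ∀ r ∈ cheegerQuotients G, c ≤ r := by
    rintro r ⟨l, hl1, hl2, rfl⟩
    have hl : l ≤ Fintype.card V := by
      have : (l : ℝ) ≤ (Fintype.card V : ℝ) := by
        linarith [Nat.cast_nonneg (α := ℝ) (Fintype.card V)]
      exact_mod_cast this
    obtain ⟨T, hT, hTb⟩ := (isoperimetricProfile_isLeast G l hl).1
    rw [le_div_iff₀ (by exact_mod_cast hl1), ← hTb, ← hT]
    exact hlow T (by rw [hT]; exact hl2)
  have hmem : (isoperimetricProfile G S.card : ℝ) / S.card ∈ cheegerQuotients G :=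
    ⟨S.card, hS1, hS2, rfl⟩
  have hprof : (isoperimetricProfile G S.card : ℝ) ≤ (edgeBoundary G S).ncard := by
    have h : isoperimetricProfile G S.card ≤ (edgeBoundary G S).ncard :=
      Nat.sInf_le ⟨S, rfl, rfl⟩
    exact_mod_cast h
  refine le_antisymm ?_ (le_csInf ⟨_, hmem⟩ hle)
  refine (csInf_le ⟨c, hle⟩ hmem).trans ?_
  rw [div_le_iff₀ (by exact_mod_cast hS1)]
  exact hprof.trans hS

/-! ### Extremal sets and the constant -/

/-- The union of the first `k` blocks. -/
def initialBlocks (n m k : ℕ) : Finset (Fin (n + 1) → Fin m) :=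
  Finset.univ.filter fun u => (u 0 : ℕ) < k

theorem card_filter_fin_val_lt {m k : ℕ} (hk : k ≤ m) :
    (Finset.univ.filter fun i : Fin m => (i : ℕ) < k).card = k := by
  simp [Fin.card_filter_val_lt, hk]

theorem card_initialBlocks {n m k : ℕ} (hk : k ≤ m) :
    (initialBlocks n m k).card = k * m ^ n := by
  rw [initialBlocks, Finset.card_filter, sum_fin_cons]
  simp only [Fin.cons_zero, Finset.sum_const, Finset.card_univ, Fintype.card_pi,
    Fintype.card_fin, Finset.prod_const, smul_eq_mul, ← Finset.mul_sum]
  rw [← Finset.card_filter, card_filter_fin_val_lt hk, mul_comm]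

/-- Boundary edges run between different blocks, and two blocks share only one edge. -/
theorem ncard_edgeBoundary_initialBlocks_le {n m k : ℕ} (hk : k ≤ m) :
    (edgeBoundary (sierpinskiGraph (n + 1) m) (initialBlocks n m k)).ncard ≤ k * (m - k) := by
  classical
  set A : Finset (Fin m) := Finset.univ.filter fun i => (i : ℕ) < k with hA
  have hcard : A.card = k := card_filter_fin_val_lt hk
  rw [ncard_edgeBoundary]
  calc _ ≤ ((A ×ˢ Aᶜ).image fun p : Fin m × Fin m =>
        ((Fin.cons p.1 fun _ => p.2 : Fin (n + 1) → Fin m),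
          (Fin.cons p.2 fun _ => p.1 : Fin (n + 1) → Fin m))).card := by
        refine Finset.card_le_card ?_
        rintro ⟨u, v⟩ huv
        induction u using Fin.consCases with | _ i u
        induction v using Fin.consCases with | _ j v
        simp only [initialBlocks, Finset.mem_filter, Finset.mem_product, Finset.mem_univ,
          true_and, Finset.mem_compl, Fin.cons_zero, sierpinskiGraph_adj_cons] at huv
        obtain ⟨⟨hi, hj⟩, ⟨rfl, _⟩ | ⟨_, rfl, rfl⟩⟩ := huv
        · exact absurd hi hj
        · exact Finset.mem_image.mpr ⟨(i, j), by simpa [hA] using ⟨hi, not_lt.mp hj⟩, rfl⟩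
    _ ≤ (A ×ˢ Aᶜ).card := Finset.card_image_le
    _ = k * (m - k) := by
        rw [Finset.card_product, Finset.card_compl, hcard, Fintype.card_fin]

theorem cheegerConstant_sierpinskiGraph_succ {n m k : ℕ} {b : ℝ} (hk : 1 ≤ k) (hkm : 2 * k ≤ m)
    (hb : b = m - k)
    (hlow : ∀ x : (Fin (n + 1) → Fin m) → ℝ, (∀ u, x u = 0 ∨ x u = 1) →
      2 * b * m * min (sierpinskiMean (n + 1) m x) (1 - sierpinskiMean (n + 1) m x) ≤
        sierpinskiVariation (n + 1) m x) :
    cheegerConstant (sierpinskiGraph (n + 1) m) = b / (m : ℝ) ^ n := by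
  have hm0 : (0 : ℝ) < m := by exact_mod_cast (by omega : 0 < m)
  have hV : (Fintype.card (Fin (n + 1) → Fin m) : ℝ) = (m : ℝ) ^ (n + 1) := by simp
  have hkmR : 2 * (k : ℝ) ≤ m := by exact_mod_cast hkm
  have hcard := card_initialBlocks (n := n) (by omega : k ≤ m)
  refine cheegerConstant_eq _ (S := initialBlocks n m k) (fun S hS => ?_) ?_ ?_ ?_
  · have h := hlow (fun u => if u ∈ S then 1 else 0) fun u => by
      by_cases hu : u ∈ S <;> simp [hu]
    rw [sierpinskiVariation_indicator, sierpinskiMean_indicator, min_eq_left] at h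
    · have e : 2 * b * m * (S.card / (m : ℝ) ^ (n + 1)) = 2 * (b / (m : ℝ) ^ n * S.card) := by
        rw [pow_succ]
        field_simp
      linarith
    · rw [hV] at hS
      have : (S.card : ℝ) / (m : ℝ) ^ (n + 1) ≤ 1 / 2 := by
        rw [div_le_iff₀ (by positivity)]
        linarith
      linarith
  · rw [hcard]
    exact Nat.mul_pos hk (pow_pos (by omega) n)
  · rw [hV, hcard, pow_succ]
    push_cast
    have : (0 : ℝ) ≤ (m : ℝ) ^ n := by positivity
    nlinarith
  · have h : ((edgeBoundary (sierpinskiGraph (n + 1) m) (initialBlocks n m k)).ncard : ℝ) ≤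
        (k * (m - k) : ℕ) := by
      exact_mod_cast ncard_edgeBoundary_initialBlocks_le (by omega : k ≤ m)
    rw [hcard]
    refine h.trans (le_of_eq ?_)
    rw [Nat.cast_mul, Nat.cast_sub (by omega), hb]
    push_cast
    field_simp

theorem mainTheorem6 (n m : ℕ) (hn : 1 ≤ n) (hm : 2 ≤ m) :
    (Even m → cheegerConstant (sierpinskiGraph n m) = 1 / (2 * (m : ℝ) ^ ((n : ℤ) - 2))) ∧
    (Odd m → cheegerConstant (sierpinskiGraph n m) = ((m : ℝ) + 1) / (2 * (m : ℝ) ^ (n - 1))) := by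
  obtain ⟨n, rfl⟩ := Nat.exists_eq_add_of_le' hn
  have hm0 : (m : ℝ) ≠ 0 := by exact_mod_cast (by omega : m ≠ 0)
  constructor
  · rintro ⟨k, hk⟩
    have hmk : (m : ℝ) = k + k := by exact_mod_cast hk
    rw [cheegerConstant_sierpinskiGraph_succ (k := k) (b := (m : ℝ) / 2) (by omega) (by omega)
      (by linarith) fun x hx => ?_]
    · have hz : (m : ℝ) ^ (((n + 1 : ℕ) : ℤ) - 2) = (m : ℝ) ^ n / m := by
        rw [show ((n + 1 : ℕ) : ℤ) - 2 = (n : ℤ) - 1 by push_cast; ring, zpow_sub_one₀ hm0,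
          zpow_natCast, div_eq_mul_inv]
      rw [hz]
      field_simp
    · have := min_mean_le_variation hm (n + 1) x hx
      rwa [mul_div_cancel₀ _ (two_ne_zero (α := ℝ))]
  · rintro ⟨k, hk⟩
    have hmk : (m : ℝ) = 2 * k + 1 := by exact_mod_cast hk
    rw [cheegerConstant_sierpinskiGraph_succ (k := k) (b := (k : ℝ) + 1) (by omega) (by omega)
      (by linarith) (min_mean_le_variation_of_odd (by omega) hk (n + 1)), Nat.add_sub_cancel, hmk]
    field_simp
    ring
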